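/- For every natural number $N$ there exists a finite simple graph $G$ with $n \ge N$ vertices such that $G$ is 1-planar (that is, $G$ can be drawn in the plane such that every edge has at most one crossing), $G$ has minimum degree exactly $7$, and every matching of $G$ has at most $\frac{11n+12}{23}$ edges. -/

import Mathlib

/-- A (good) drawing of a simple graph in the plane: vertices are distinct points, every edge is a
simple arc joining the points of its two ends and passing through no other vertex, and two edges
with a common end meet in that end only. -/
structure PlaneDrawing {V : Type*} (G : SimpleGraph V) where
  /-- the point representing a vertex -/
  pos : V → ℝ × ℝ
  /-- the point set representing an edge (irrelevant for pairs that are not edges) -/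
  arc : Sym2 V → Set (ℝ × ℝ)
  pos_injective : Function.Injective pos
  arc_isSimple : ∀ u v : V, G.Adj u v →
    ∃ γ : Path (pos u) (pos v), Function.Injective γ ∧ Set.range γ = arc s(u, v)
  mem_of_pos_mem_arc : ∀ e ∈ G.edgeSet, ∀ w : V, pos w ∈ arc e → w ∈ e
  arc_inter_of_adjacent : ∀ e ∈ G.edgeSet, ∀ f ∈ G.edgeSet, e ≠ f →
    ∀ w : V, w ∈ e → w ∈ f → arc e ∩ arc f = {pos w}

/-- The crossings of the edge `e` in a drawing, as pairs of another edge `f` and a point common to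
`e` and `f` that is not a vertex. A point where `e` meets several other edges counts once for each
of them, and a point where `e` merely touches `f` is counted too. -/
def PlaneDrawing.crossings {V : Type*} {G : SimpleGraph V} (D : PlaneDrawing G) (e : Sym2 V) :
    Set (Sym2 V × (ℝ × ℝ)) :=
  {c | c.1 ∈ G.edgeSet ∧ c.1 ≠ e ∧ c.2 ∈ D.arc e ∧ c.2 ∈ D.arc c.1 ∧ c.2 ∉ Set.range D.pos}

/-- A graph is 1-planar if it can be drawn in the plane such that every edge has at most one
crossing. -/
def IsOnePlanar {V : Type*} (G : SimpleGraph V) : Prop :=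
  ∃ D : PlaneDrawing G, ∀ e ∈ G.edgeSet, (D.crossings e).Subsingleton

/-!
The rhombicuboctahedron with both diagonals of each of its 18 squares is a 7-regular 1-planar graph
on 24 vertices. Glue `N + 1` copies of it together at one vertex. Only this vertex changes its
degree, which becomes larger. Deleting it leaves `N + 1` parts of 23 vertices with no edges between
them; as 23 is odd, a matching has at most 11 edges in each of them, and at most one more at the
common vertex. The copies can be drawn without interfering, since a drawing in the first quadrant
with the common vertex at the origin can be squeezed linearly into any of `N + 1` disjoint sectors.
-/

open SimpleGraph Set

/-- Twice the signed area of the triangle `a b c`. -/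
def orientation {R : Type*} [CommRing R] (a b c : R × R) : R :=
  (b.1 - a.1) * (c.2 - a.2) - (b.2 - a.2) * (c.1 - a.1)

/-- The open segments from `a` to `b` and from `c` to `d` cross transversally: each of them
separates the ends of the other one. -/
def SegmentsCross {R : Type*} [CommRing R] [LT R] (a b c d : R × R) : Prop :=
  orientation a b c * orientation a b d < 0 ∧ orientation c d a * orientation c d b < 0

instance {R : Type*} [CommRing R] [LT R] [DecidableLT R] (a b c d : R × R) :
    Decidable (SegmentsCross a b c d) :=
  inferInstanceAs (Decidable (_ ∧ _))

section Orientation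

lemma orientation_smul_add_smul {R : Type*} [CommRing R] (a b c d : R × R) {s t : R}
    (hst : s + t = 1) :
    orientation a b (s • c + t • d) = s * orientation a b c + t * orientation a b d := by
  obtain rfl : s = 1 - t := eq_sub_of_add_eq hst
  simp only [orientation, Prod.fst_add, Prod.snd_add, Prod.smul_fst, Prod.smul_snd, smul_eq_mul]
  ring

lemma orientation_intCast {R : Type*} [CommRing R] (a b c : ℤ × ℤ) :
    orientation (Prod.map (Int.cast : ℤ → R) Int.cast a) (Prod.map Int.cast Int.cast b)
      (Prod.map Int.cast Int.cast c) = (orientation a b c : ℤ) := by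
  simp only [orientation, Prod.map_fst, Prod.map_snd]
  push_cast
  rfl

lemma orientation_eq_zero_of_mem_segment {R : Type*} [CommRing R] [PartialOrder R]
    {a b p : R × R} (hp : p ∈ segment R a b) : orientation a b p = 0 := by
  obtain ⟨s, t, -, -, hst, rfl⟩ := hp
  rw [orientation_smul_add_smul _ _ _ _ hst]
  simp only [orientation]
  ring

variable {R : Type*} [CommRing R] [LinearOrder R] [IsStrictOrderedRing R]

lemma segmentsCross_intCast {a b c d : ℤ × ℤ} :
    SegmentsCross (Prod.map (Int.cast : ℤ → R) Int.cast a) (Prod.map Int.cast Int.cast b)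
      (Prod.map Int.cast Int.cast c) (Prod.map Int.cast Int.cast d) ↔ SegmentsCross a b c d := by
  simp only [SegmentsCross, orientation_intCast]
  norm_cast

variable {a b c d p : R × R}

lemma orientation_mul_orientation_neg_of_mem_segment (hc : orientation a b c ≠ 0)
    (hd : orientation a b d ≠ 0) (hab : p ∈ segment R a b) (hcd : p ∈ segment R c d) :
    orientation a b c * orientation a b d < 0 := by
  have h0 := orientation_eq_zero_of_mem_segment hab
  obtain ⟨s, t, hs, ht, hst, rfl⟩ := hcd
  rw [orientation_smul_add_smul _ _ _ _ hst] at h0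
  by_contra! hcd
  have h_sq : s * orientation a b c ^ 2 + t * (orientation a b c * orientation a b d) = 0 := by
    linear_combination orientation a b c * h0
  have hs0 : s * orientation a b c ^ 2 = 0 := by
    linarith [mul_nonneg hs (sq_nonneg (orientation a b c)), mul_nonneg ht hcd]
  obtain rfl : s = 0 := (mul_eq_zero.1 hs0).resolve_right (pow_ne_zero 2 hc)
  obtain rfl : t = 1 := by linarith
  exact hd (by linarith)

lemma segmentsCross_of_mem_segment_inter (habc : orientation a b c ≠ 0)
    (habd : orientation a b d ≠ 0) (hcda : orientation c d a ≠ 0) (hcdb : orientation c d b ≠ 0)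
    (hp : p ∈ segment R a b ∩ segment R c d) : SegmentsCross a b c d :=
  ⟨orientation_mul_orientation_neg_of_mem_segment habc habd hp.1 hp.2,
    orientation_mul_orientation_neg_of_mem_segment hcda hcdb hp.2 hp.1⟩

lemma segment_inter_segment_subsingleton_of_orientation_ne
    (h : orientation a b c ≠ orientation a b d) :
    (segment R a b ∩ segment R c d).Subsingleton := by
  rintro p ⟨hp, s, t, -, -, hst, rfl⟩ q ⟨hq, s', t', -, -, hst', rfl⟩
  replace hp := orientation_eq_zero_of_mem_segment hp
  replace hq := orientation_eq_zero_of_mem_segment hq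
  rw [orientation_smul_add_smul _ _ _ _ hst] at hp
  rw [orientation_smul_add_smul _ _ _ _ hst'] at hq
  obtain rfl : t = 1 - s := eq_sub_of_add_eq' hst
  obtain rfl : t' = 1 - s' := eq_sub_of_add_eq' hst'
  have hs : (s - s') * (orientation a b c - orientation a b d) = 0 := by
    linear_combination hp - hq
  obtain rfl : s = s' := sub_eq_zero.1 ((mul_eq_zero.1 hs).resolve_right (sub_ne_zero.2 h))
  rfl

lemma SegmentsCross.segment_inter_subsingleton (h : SegmentsCross a b c d) :
    (segment R a b ∩ segment R c d).Subsingleton := by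
  refine segment_inter_segment_subsingleton_of_orientation_ne fun heq => ?_
  have := h.1
  rw [heq] at this
  exact this.not_ge (mul_self_nonneg _)

lemma segment_inter_segment_eq_singleton_of_orientation_ne_zero (h : orientation a b c ≠ 0) :
    segment R a b ∩ segment R a c = {a} := by
  have ha : orientation a b a ≠ orientation a b c := by
    rw [orientation_eq_zero_of_mem_segment (left_mem_segment R a b)]
    exact h.symm
  exact (segment_inter_segment_subsingleton_of_orientation_ne ha).eq_singleton_of_mem
    ⟨left_mem_segment R a b, left_mem_segment R a c⟩

end Orientation

namespace PlaneDrawing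

variable {V : Type*} {G : SimpleGraph V}

/-- The part of the plane that a drawing occupies. -/
def support (D : PlaneDrawing G) : Set (ℝ × ℝ) :=
  range D.pos ∪ ⋃ e ∈ G.edgeSet, D.arc e

lemma pos_mem_support (D : PlaneDrawing G) (v : V) : D.pos v ∈ D.support :=
  Or.inl (mem_range_self v)

lemma arc_subset_support (D : PlaneDrawing G) {e : Sym2 V} (he : e ∈ G.edgeSet) :
    D.arc e ⊆ D.support :=
  (subset_biUnion_of_mem (u := D.arc) he).trans subset_union_right

lemma pos_mem_arc (D : PlaneDrawing G) {e : Sym2 V} (he : e ∈ G.edgeSet) {v : V} (hv : v ∈ e) :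
    D.pos v ∈ D.arc e := by
  obtain ⟨w, rfl⟩ := hv
  obtain ⟨γ, -, hγ⟩ := D.arc_isSimple v w he
  exact hγ ▸ ⟨0, γ.source⟩

/-- The image of a drawing under a continuous injection of the plane into itself. -/
def map (D : PlaneDrawing G) (φ : ℝ × ℝ → ℝ × ℝ) (hφ : Continuous φ)
    (hφ' : Function.Injective φ) : PlaneDrawing G where
  pos v := φ (D.pos v)
  arc e := φ '' D.arc e
  pos_injective := hφ'.comp D.pos_injective
  arc_isSimple u v huv := by
    obtain ⟨γ, hγ, hrange⟩ := D.arc_isSimple u v huv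
    exact ⟨γ.map hφ, hφ'.comp hγ, by rw [← hrange, ← range_comp]; rfl⟩
  mem_of_pos_mem_arc e he w hw := D.mem_of_pos_mem_arc e he w (hφ'.mem_set_image.1 hw)
  arc_inter_of_adjacent e he f hf hef w hwe hwf := by
    rw [← image_inter hφ', D.arc_inter_of_adjacent e he f hf hef w hwe hwf, image_singleton]

lemma support_map (D : PlaneDrawing G) {φ : ℝ × ℝ → ℝ × ℝ} (hφ : Continuous φ)
    (hφ' : Function.Injective φ) : (D.map φ hφ hφ').support = φ '' D.support := by
  simp only [support, map, image_union, image_iUnion, ← range_comp]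
  rfl

lemma crossings_map (D : PlaneDrawing G) {φ : ℝ × ℝ → ℝ × ℝ} (hφ : Continuous φ)
    (hφ' : Function.Injective φ) (e : Sym2 V) :
    (D.map φ hφ hφ').crossings e = Prod.map id φ '' D.crossings e := by
  ext ⟨f, p⟩
  constructor
  · rintro ⟨hf, hfe, ⟨q, hqe, rfl⟩, hqf, hq⟩
    exact ⟨(f, q), ⟨hf, hfe, hqe, hφ'.mem_set_image.1 hqf,
      fun ⟨v, hv⟩ => hq ⟨v, congrArg φ hv⟩⟩, rfl⟩
  · rintro ⟨⟨g, q⟩, ⟨hg, hge, hqe, hqg, hq⟩, heq⟩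
    obtain ⟨rfl, rfl⟩ := Prod.mk.inj heq
    exact ⟨hg, hge, mem_image_of_mem φ hqe, mem_image_of_mem φ hqg,
      fun ⟨v, hv⟩ => hq ⟨v, hφ' hv⟩⟩

end PlaneDrawing

section StraightLine

variable {V : Type*} {G : SimpleGraph V}

/-- A placement of the vertices of a graph in the plane over `R` such that no vertex lies on the
line through the ends of an edge, except for these ends. -/
structure InEdgeGeneralPosition {R : Type*} [CommRing R] (G : SimpleGraph V) (pos : V → R × R) :
    Prop where
  injective : Function.Injective pos
  orientation_ne_zero : ∀ u v : V, G.Adj u v → ∀ w : V, w ≠ u → w ≠ v →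
    orientation (pos u) (pos v) (pos w) ≠ 0

lemma InEdgeGeneralPosition.intCast {R : Type*} [CommRing R] [CharZero R] {pos : V → ℤ × ℤ}
    (h : InEdgeGeneralPosition G pos) :
    InEdgeGeneralPosition G fun v => Prod.map (Int.cast : ℤ → R) Int.cast (pos v) where
  injective := (Int.cast_injective.prodMap Int.cast_injective).comp h.injective
  orientation_ne_zero u v huv w hwu hwv := by
    rw [orientation_intCast, Int.cast_ne_zero]
    exact h.orientation_ne_zero u v huv w hwu hwv

variable {pos : V → ℝ × ℝ}

/-- The drawing with prescribed vertices and straight edges. -/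
def straightLineDrawing (h : InEdgeGeneralPosition G pos) : PlaneDrawing G where
  pos := pos
  arc := Sym2.lift ⟨fun u v => segment ℝ (pos u) (pos v), fun _ _ => segment_symm ℝ _ _⟩
  pos_injective := h.injective
  arc_isSimple u v huv :=
    ⟨Path.segment _ _, Path.segment_injective_of_ne (h.injective.ne huv.ne),
      Path.range_segment _ _⟩
  mem_of_pos_mem_arc e he w hw := by
    induction e with | _ u v =>
    by_contra hwe
    rw [Sym2.mem_iff, not_or] at hwe
    exact h.orientation_ne_zero u v he w hwe.1 hwe.2 (orientation_eq_zero_of_mem_segment hw)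
  arc_inter_of_adjacent e he f hf hef w hwe hwf := by
    obtain ⟨u, rfl⟩ := hwe
    obtain ⟨v, rfl⟩ := hwf
    exact segment_inter_segment_eq_singleton_of_orientation_ne_zero
      (h.orientation_ne_zero w u he v (G.ne_of_adj hf).symm fun hvu => hef (hvu ▸ rfl))

lemma support_straightLineDrawing_subset (h : InEdgeGeneralPosition G pos) {C : Set (ℝ × ℝ)}
    (hC : Convex ℝ C) (hpos : ∀ v, pos v ∈ C) : (straightLineDrawing h).support ⊆ C := by
  refine union_subset (range_subset_iff.2 hpos) (iUnion₂_subset fun e _ => ?_)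
  induction e with | _ u v =>
  exact hC.segment_subset (hpos u) (hpos v)

lemma segmentsCross_of_mem_crossings (h : InEdgeGeneralPosition G pos) {a b c d : V}
    (hab : G.Adj a b) {p : ℝ × ℝ} (hp : (s(c, d), p) ∈ (straightLineDrawing h).crossings s(a, b)) :
    SegmentsCross (pos a) (pos b) (pos c) (pos d) := by
  obtain ⟨hcd, hne, hpab, hpcd, hp⟩ := hp
  have hdisj : ∀ v, v ∈ s(a, b) → v ∉ s(c, d) := fun v hvab hvcd => by
    have hpv : p ∈ ({pos v} : Set (ℝ × ℝ)) :=
      (straightLineDrawing h).arc_inter_of_adjacent _ hab _ hcd hne.symm v hvab hvcd ▸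
        ⟨hpab, hpcd⟩
    exact hp ⟨v, hpv.symm⟩
  simp only [Sym2.mem_iff, forall_eq_or_imp, forall_eq, not_or] at hdisj
  obtain ⟨⟨hac, had⟩, hbc, hbd⟩ := hdisj
  exact segmentsCross_of_mem_segment_inter
    (h.orientation_ne_zero a b hab c (Ne.symm hac) (Ne.symm hbc))
    (h.orientation_ne_zero a b hab d (Ne.symm had) (Ne.symm hbd))
    (h.orientation_ne_zero c d hcd a hac had) (h.orientation_ne_zero c d hcd b hbc hbd)
    ⟨hpab, hpcd⟩

lemma crossings_straightLineDrawing_subsingleton (h : InEdgeGeneralPosition G pos)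
    (hcross : ∀ a b c d c' d', G.Adj a b → G.Adj c d → G.Adj c' d' →
      SegmentsCross (pos a) (pos b) (pos c) (pos d) →
      SegmentsCross (pos a) (pos b) (pos c') (pos d') → s(c, d) = s(c', d'))
    {e : Sym2 V} (he : e ∈ G.edgeSet) : ((straightLineDrawing h).crossings e).Subsingleton := by
  induction e with | _ a b =>
  rintro ⟨f, p⟩ hp ⟨f', q⟩ hq
  induction f with | _ c d =>
  induction f' with | _ c' d' =>
  have hcd := segmentsCross_of_mem_crossings h he hp
  have heq : s(c, d) = s(c', d') := hcross a b c d c' d' he hp.1 hq.1 hcd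
    (segmentsCross_of_mem_crossings h he hq)
  have hq' : q ∈ (straightLineDrawing h).arc s(c, d) := heq ▸ hq.2.2.2.1
  exact Prod.ext heq
    (hcd.segment_inter_subsingleton ⟨hp.2.2.1, hp.2.2.2.1⟩ ⟨hq.2.2.1, hq'⟩)

end StraightLine

section Bouquet

variable {V ι : Type*} {G : SimpleGraph V} {r : V}

/-- Drawings of a graph that send the vertex `r` to `o` and meet each other nowhere else, so that
together they draw a bouquet. -/
structure IsWedge (D : ι → PlaneDrawing G) (r : V) (o : ℝ × ℝ) : Prop where
  pos_root : ∀ i, (D i).pos r = o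
  support_inter_subset : ∀ i j, i ≠ j → (D i).support ∩ (D j).support ⊆ {o}

lemma IsWedge.eq_or_eq_root {D : ι → PlaneDrawing G} {o : ℝ × ℝ}
    (h : IsWedge D r o) {i j : ι} {v : V} (hv : (D i).pos v ∈ (D j).support) :
    i = j ∨ v = r := by
  by_contra! hne
  have hvo : (D i).pos v = o :=
    h.support_inter_subset i j hne.1 ⟨(D i).pos_mem_support v, hv⟩
  exact hne.2 ((D i).pos_injective (hvo.trans (h.pos_root i).symm))

/-- The linear map of the plane that sends the first quadrant to the sector of the half-plane
`0 ≤ x` between the slopes `c` and `c + 1`. -/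
def fan (c : ℝ) (p : ℝ × ℝ) : ℝ × ℝ := (p.1 + p.2, c * p.1 + (c + 1) * p.2)

lemma continuous_fan (c : ℝ) : Continuous (fan c) := by
  unfold fan
  fun_prop

lemma fan_injective (c : ℝ) : Function.Injective (fan c) := by
  intro p q hpq
  obtain ⟨h₁, h₂⟩ := Prod.mk.inj hpq
  have h_snd : p.2 = q.2 := by linear_combination h₂ - c * h₁
  exact Prod.ext (by linear_combination h₁ - h_snd) h_snd

lemma fan_zero (c : ℝ) : fan c 0 = 0 := by
  simp [fan]

lemma fan_snd_mem_Icc (c : ℝ) {p : ℝ × ℝ} (hp : 0 ≤ p) :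
    (fan c p).2 ∈ Icc (c * (fan c p).1) ((c + 1) * (fan c p).1) := by
  obtain ⟨h₁, h₂⟩ := hp
  constructor <;> simp only [fan, Prod.fst_zero, Prod.snd_zero] at * <;> linarith

lemma fan_image_inter_fan_image_subset {c c' : ℝ} (hcc' : c + 1 < c') :
    fan c '' Ici 0 ∩ fan c' '' Ici 0 ⊆ {0} := by
  rintro _ ⟨⟨p, hp, rfl⟩, ⟨q, hq, hqp⟩⟩
  have h_upper := (fan_snd_mem_Icc c hp).2
  have h_lower := (fan_snd_mem_Icc c' hq).1
  rw [hqp] at h_lower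
  have h_fst : p.1 + p.2 ≤ 0 := by
    by_contra! h_pos
    exact (h_lower.trans h_upper).not_gt (mul_lt_mul_of_pos_right hcc' h_pos)
  obtain ⟨h₁ : 0 ≤ p.1, h₂ : 0 ≤ p.2⟩ := hp
  obtain rfl : p = 0 := Prod.ext (show p.1 = 0 by linarith) (show p.2 = 0 by linarith)
  exact fan_zero c

lemma isWedge_map_fan (D : PlaneDrawing G) (h_root : D.pos r = 0) (h_quadrant : D.support ⊆ Ici 0)
    {n : ι → ℕ} (hn : Function.Injective n) :
    IsWedge (fun i => D.map (fan (2 * n i)) (continuous_fan _) (fan_injective _)) r 0 := by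
  have h_sectors : ∀ i j, n i < n j → fan (2 * n i) '' Ici 0 ∩ fan (2 * n j) '' Ici 0 ⊆ {0} := by
    intro i j hij
    refine fan_image_inter_fan_image_subset ?_
    norm_cast
    lia
  refine ⟨fun i => ?_, fun i j hij => ?_⟩
  · change fan (2 * n i) (D.pos r) = 0
    rw [h_root, fan_zero]
  · simp only [PlaneDrawing.support_map]
    refine (inter_subset_inter (image_mono h_quadrant) (image_mono h_quadrant)).trans ?_
    obtain hlt | hgt := (hn.ne hij).lt_or_gt
    · exact h_sectors i j hlt
    · exact inter_comm _ _ ▸ h_sectors j i hgt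

/-- The vertices of the bouquet of `ι` copies of a graph on `V` rooted at `r`: the common root
`none`, and the other vertices of each copy. -/
abbrev BouquetVertex (r : V) (ι : Type*) := Option (ι × {v : V // v ≠ r})

lemma card_bouquetVertex [Fintype V] [Fintype ι] [DecidableEq V] :
    Fintype.card (BouquetVertex r ι) = Fintype.card ι * (Fintype.card V - 1) + 1 := by
  rw [Fintype.card_option, Fintype.card_prod, Fintype.card_subtype_compl,
    Fintype.card_subtype_eq]

/-- The position of a vertex in the union of the drawings `D i`. -/
def bouquetPos (D : ι → PlaneDrawing G) (o : ℝ × ℝ) : BouquetVertex r ι → ℝ × ℝ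
  | none => o
  | some (i, v) => (D i).pos v

lemma IsWedge.bouquetPos_injective {D : ι → PlaneDrawing G} {o : ℝ × ℝ} (h : IsWedge D r o) :
    Function.Injective (bouquetPos (r := r) D o) := by
  rintro (_ | ⟨i, u⟩) (_ | ⟨j, v⟩) hxy
  · rfl
  · exact absurd ((D j).pos_injective ((h.pos_root j).trans hxy)).symm v.2
  · exact absurd ((D i).pos_injective (hxy.trans (h.pos_root i).symm)) u.2
  · replace hxy : (D i).pos u = (D j).pos v := hxy
    obtain rfl := (h.eq_or_eq_root (hxy ▸ (D j).pos_mem_support v)).resolve_right u.2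
    rw [Subtype.ext ((D i).pos_injective hxy)]

variable [DecidableEq V]

/-- The inclusion of the `i`-th copy into the bouquet. -/
def bouquetIncl (r : V) (i : ι) : V ↪ BouquetVertex r ι where
  toFun v := if h : v = r then none else some (i, ⟨v, h⟩)
  inj' u v huv := by grind

lemma bouquetIncl_root (i : ι) : bouquetIncl r i r = none :=
  dif_pos rfl

lemma bouquetIncl_coe (i : ι) (v : {v : V // v ≠ r}) : bouquetIncl r i v = some (i, v) :=
  dif_neg v.2

lemma bouquetIncl_eq_bouquetIncl_iff {i j : ι} {u v : V} :
    bouquetIncl r i u = bouquetIncl r j v ↔ u = v ∧ (i = j ∨ u = r) := by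
  change dite _ _ _ = dite _ _ _ ↔ _
  grind

lemma exists_bouquetIncl_eq [Nonempty ι] (x : BouquetVertex r ι) :
    ∃ (i : ι) (v : V), bouquetIncl r i v = x := by
  obtain _ | ⟨i, v⟩ := x
  · exact ⟨Classical.arbitrary ι, r, bouquetIncl_root _⟩
  · exact ⟨i, v, bouquetIncl_coe i v⟩

lemma map_bouquetIncl_eq_map_bouquetIncl_iff {i j : ι} {e f : Sym2 V} (he : ¬e.IsDiag) :
    e.map (bouquetIncl r i) = f.map (bouquetIncl r j) ↔ i = j ∧ e = f := by
  induction e with | _ a b =>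
  induction f with | _ c d =>
  simp only [Sym2.map_mk, Sym2.eq_iff, bouquetIncl_eq_bouquetIncl_iff]
  rw [Sym2.mk_isDiag_iff] at he
  grind

/-- The bouquet of `ι` copies of a graph: the disjoint copies glued together at the root `r`. -/
def bouquet (G : SimpleGraph V) (r : V) (ι : Type*) : SimpleGraph (BouquetVertex r ι) :=
  ⨆ i, G.map (bouquetIncl r i)

lemma bouquet_adj {x y : BouquetVertex r ι} :
    (bouquet G r ι).Adj x y ↔
      ∃ i u v, G.Adj u v ∧ bouquetIncl r i u = x ∧ bouquetIncl r i v = y := by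
  simp only [bouquet, iSup_adj, map_adj]

lemma mem_edgeSet_bouquet {e : Sym2 (BouquetVertex r ι)} :
    e ∈ (bouquet G r ι).edgeSet ↔ ∃ i, ∃ f ∈ G.edgeSet, f.map (bouquetIncl r i) = e := by
  simp only [bouquet, edgeSet_iSup, edgeSet_map, mem_iUnion, mem_image]
  rfl

/-- The arc of an edge in the union of the drawings `D i`. -/
def bouquetArc (D : ι → PlaneDrawing G) (e : Sym2 (BouquetVertex r ι)) : Set (ℝ × ℝ) :=
  {p | ∃ i, ∃ f ∈ G.edgeSet, f.map (bouquetIncl r i) = e ∧ p ∈ (D i).arc f}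

lemma bouquetArc_map_bouquetIncl (D : ι → PlaneDrawing G) (i : ι) {f : Sym2 V}
    (hf : f ∈ G.edgeSet) :
    bouquetArc D (f.map (bouquetIncl r i)) = (D i).arc f := by
  ext p
  constructor
  · rintro ⟨j, g, hg, hgf, hp⟩
    obtain ⟨rfl, rfl⟩ :=
      (map_bouquetIncl_eq_map_bouquetIncl_iff (G.not_isDiag_of_mem_edgeSet hg)).1 hgf
    exact hp
  · exact fun hp => ⟨i, f, hf, rfl, hp⟩

namespace IsWedge

variable {D : ι → PlaneDrawing G} {o : ℝ × ℝ}

lemma bouquetPos_bouquetIncl (h : IsWedge D r o) (i : ι) (v : V) :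
    bouquetPos D o (bouquetIncl r i v) = (D i).pos v := by
  by_cases hv : v = r
  · rw [hv, bouquetIncl_root, h.pos_root, bouquetPos]
  · exact congrArg (bouquetPos D o) (bouquetIncl_coe i ⟨v, hv⟩)

lemma bouquetArc_inter_bouquetArc (h : IsWedge D r o) {e f : Sym2 (BouquetVertex r ι)}
    (he : e ∈ (bouquet G r ι).edgeSet) (hf : f ∈ (bouquet G r ι).edgeSet) (hef : e ≠ f)
    {x : BouquetVertex r ι} (hxe : x ∈ e) (hxf : x ∈ f) :
    bouquetArc D e ∩ bouquetArc D f = {bouquetPos D o x} := by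
  obtain ⟨i, e', he', rfl⟩ := mem_edgeSet_bouquet.1 he
  obtain ⟨j, f', hf', rfl⟩ := mem_edgeSet_bouquet.1 hf
  obtain ⟨u, hu, rfl⟩ := Sym2.mem_map.1 hxe
  obtain ⟨v, hv, hvu⟩ := Sym2.mem_map.1 hxf
  obtain ⟨rfl, hji⟩ := bouquetIncl_eq_bouquetIncl_iff.1 hvu
  rw [bouquetArc_map_bouquetIncl D i he', bouquetArc_map_bouquetIncl D j hf',
    h.bouquetPos_bouquetIncl]
  obtain rfl | hij := eq_or_ne i j
  · exact (D i).arc_inter_of_adjacent e' he' f' hf' (fun heq => hef (heq ▸ rfl)) v hu hv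
  · obtain rfl : v = r := hji.resolve_left hij.symm
    refine Subset.antisymm ?_ (singleton_subset_iff.2 ⟨(D i).pos_mem_arc he' hu, ?_⟩)
    · rw [h.pos_root]
      exact (inter_subset_inter ((D i).arc_subset_support he') ((D j).arc_subset_support hf')).trans
        (h.support_inter_subset i j hij)
    · rw [h.pos_root, ← h.pos_root j]
      exact (D j).pos_mem_arc hf' hv

/-- The union of the drawings `D i`, as a drawing of the bouquet. -/
def drawing (h : IsWedge D r o) : PlaneDrawing (bouquet G r ι) where
  pos := bouquetPos D o
  arc := bouquetArc D
  pos_injective := h.bouquetPos_injective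
  arc_isSimple x y hxy := by
    obtain ⟨i, u, v, huv, rfl, rfl⟩ := bouquet_adj.1 hxy
    rw [h.bouquetPos_bouquetIncl, h.bouquetPos_bouquetIncl, ← Sym2.map_mk,
      bouquetArc_map_bouquetIncl D i huv]
    exact (D i).arc_isSimple u v huv
  mem_of_pos_mem_arc e he x hx := by
    obtain ⟨i, f, hf, rfl⟩ := mem_edgeSet_bouquet.1 he
    have : Nonempty ι := ⟨i⟩
    obtain ⟨j, v, rfl⟩ := exists_bouquetIncl_eq x
    rw [h.bouquetPos_bouquetIncl, bouquetArc_map_bouquetIncl D i hf] at hx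
    have hji := h.eq_or_eq_root ((D i).arc_subset_support hf hx)
    have hpos : (D j).pos v = (D i).pos v := by
      obtain rfl | rfl := hji
      exacts [rfl, (h.pos_root j).trans (h.pos_root i).symm]
    rw [bouquetIncl_eq_bouquetIncl_iff.2 ⟨rfl, hji⟩]
    exact Sym2.mem_map.2 ⟨v, (D i).mem_of_pos_mem_arc f hf v (hpos ▸ hx), rfl⟩
  arc_inter_of_adjacent _ he _ hf hef _ hxe hxf := h.bouquetArc_inter_bouquetArc he hf hef hxe hxf

lemma crossings_drawing_subset (h : IsWedge D r o) (i : ι) {f : Sym2 V}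
    (hf : f ∈ G.edgeSet) :
    h.drawing.crossings (f.map (bouquetIncl r i)) ⊆
      Prod.map (Sym2.map (bouquetIncl r i)) id '' (D i).crossings f := by
  rintro ⟨e, p⟩ ⟨he, hef, hpf, hpe, hp⟩
  obtain ⟨j, g, hg, rfl⟩ := mem_edgeSet_bouquet.1 he
  replace hpf : p ∈ (D i).arc f := bouquetArc_map_bouquetIncl D i hf ▸ hpf
  replace hpe : p ∈ (D j).arc g := bouquetArc_map_bouquetIncl D j hg ▸ hpe
  have hij : i = j := by
    by_contra hij
    have hpo : p = o := h.support_inter_subset i j hij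
      ⟨(D i).arc_subset_support hf hpf, (D j).arc_subset_support hg hpe⟩
    exact hp ⟨none, hpo.symm⟩
  subst hij
  refine ⟨(g, p), ⟨hg, fun hgf => hef (congrArg _ hgf), hpf, hpe, ?_⟩, rfl⟩
  rintro ⟨v, rfl⟩
  exact hp ⟨bouquetIncl r i v, h.bouquetPos_bouquetIncl i v⟩

lemma isOnePlanar_bouquet (h : IsWedge D r o)
    (hD : ∀ i, ∀ f ∈ G.edgeSet, ((D i).crossings f).Subsingleton) :
    IsOnePlanar (bouquet G r ι) := by
  refine ⟨h.drawing, fun e he => ?_⟩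
  obtain ⟨i, f, hf, rfl⟩ := mem_edgeSet_bouquet.1 he
  exact ((hD i f hf).image _).anti (h.crossings_drawing_subset i hf)

end IsWedge

lemma isOnePlanar_bouquet [Countable ι] (D : PlaneDrawing G) (h_root : D.pos r = 0)
    (h_quadrant : D.support ⊆ Ici 0) (hD : ∀ e ∈ G.edgeSet, (D.crossings e).Subsingleton) :
    IsOnePlanar (bouquet G r ι) := by
  obtain ⟨n, hn⟩ := exists_injective_nat ι
  refine (isWedge_map_fan D h_root h_quadrant hn).isOnePlanar_bouquet fun i e he => ?_
  rw [PlaneDrawing.crossings_map]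
  exact (hD e he).image _

section Degree

variable [Fintype V] [DecidableRel G.Adj] [Fintype ι] [DecidableRel (bouquet G r ι).Adj]

lemma degree_le_degree_bouquetIncl (i : ι) (v : V) :
    G.degree v ≤ (bouquet G r ι).degree (bouquetIncl r i v) :=
  Copy.degree_le ⟨⟨bouquetIncl r i, fun hab => bouquet_adj.2 ⟨i, _, _, hab, rfl, rfl⟩⟩,
    (bouquetIncl r i).injective⟩ v

lemma degree_bouquetIncl_le_degree (i : ι) {v : V} (hv : v ≠ r) :
    (bouquet G r ι).degree (bouquetIncl r i v) ≤ G.degree v := by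
  rw [← card_neighborFinset_eq_degree, ← card_neighborFinset_eq_degree,
    ← Finset.card_map (bouquetIncl r i)]
  refine Finset.card_le_card fun x hx => ?_
  obtain ⟨j, u, w, huw, huv, rfl⟩ := bouquet_adj.1 ((mem_neighborFinset _ _ _).1 hx)
  obtain ⟨rfl, hji⟩ := bouquetIncl_eq_bouquetIncl_iff.1 huv
  obtain rfl := hji.resolve_right hv
  exact Finset.mem_map_of_mem _ ((mem_neighborFinset _ _ _).2 huw)

lemma minDegree_bouquet [Nontrivial V] [Nonempty ι] {k : ℕ} (hG : G.IsRegularOfDegree k) :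
    (bouquet G r ι).minDegree = k := by
  refine le_antisymm ?_ (le_minDegree_of_forall_le_degree _ _ fun x => ?_)
  · obtain ⟨v, hv⟩ := exists_ne r
    rw [← hG v]
    exact (minDegree_le_degree _ _).trans
      (degree_bouquetIncl_le_degree (Classical.arbitrary ι) hv)
  · obtain ⟨i, v, rfl⟩ := exists_bouquetIncl_eq x
    rw [← hG v]
    exact degree_le_degree_bouquetIncl i v

end Degree

end Bouquet

section Matching

variable {V : Type*} {G : SimpleGraph V} {M : G.Subgraph}

lemma eq_of_mem_edgeSet_of_isMatching (hM : M.IsMatching) {e f : Sym2 V} (he : e ∈ M.edgeSet)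
    (hf : f ∈ M.edgeSet) {v : V} (hve : v ∈ e) (hvf : v ∈ f) : e = f := by
  obtain ⟨a, rfl⟩ := hve
  obtain ⟨b, rfl⟩ := hvf
  rw [hM.eq_of_adj_left (Subgraph.mem_edgeSet.1 he) (Subgraph.mem_edgeSet.1 hf)]

variable {F : Finset (Sym2 V)}

lemma card_le_of_isMatching_of_meets (hM : M.IsMatching) (hF : ↑F ⊆ M.edgeSet) {S : Finset V}
    (hS : ∀ e ∈ F, ∃ v ∈ S, v ∈ e) : F.card ≤ S.card :=
  Finset.card_le_card_of_forall_subsingleton (fun e v => v ∈ e) hS fun _ _ _ he _ hf =>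
    eq_of_mem_edgeSet_of_isMatching hM (hF he.1) (hF hf.1) he.2 hf.2

lemma card_mul_two_le_of_isMatching (hM : M.IsMatching) (hF : ↑F ⊆ M.edgeSet) {W : Finset V}
    (hW : ∀ e ∈ F, ∀ v ∈ e, v ∈ W) : F.card * 2 ≤ W.card := by
  classical
  rw [← mul_one W.card]
  refine Finset.card_mul_le_card_mul (fun e v => v ∈ e) (fun e he => ?_) fun v _ => ?_
  · rw [← Sym2.card_toFinset_of_not_isDiag e
      (G.not_isDiag_of_mem_edgeSet (M.edgeSet_subset (hF he)))]
    refine Finset.card_le_card fun v hv => ?_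
    rw [Sym2.mem_toFinset] at hv
    exact Finset.mem_filter.2 ⟨hW e he v hv, hv⟩
  · refine Finset.card_le_one.2 fun e he f hf => ?_
    rw [Finset.mem_bipartiteBelow] at he hf
    exact eq_of_mem_edgeSet_of_isMatching hM (hF he.1) (hF hf.1) he.2 hf.2

/-- The easy half of the Tutte–Berge formula, where deleting `S` leaves the parts `W i`. -/
lemma ncard_edgeSet_le_of_isMatching [Finite V] {ι : Type*} [Fintype ι] (hM : M.IsMatching)
    (S : Finset V) (W : ι → Finset V)
    (hSW : ∀ e ∈ G.edgeSet, (∃ v ∈ S, v ∈ e) ∨ ∃ i, ∀ v ∈ e, v ∈ W i) :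
    M.edgeSet.ncard ≤ S.card + ∑ i, (W i).card / 2 := by
  classical
  have := Fintype.ofFinite V
  let E := M.edgeSet.toFinset
  have h_sub {A : Finset (Sym2 V)} (hA : A ⊆ E) : ↑A ⊆ M.edgeSet :=
    (Finset.coe_subset.2 hA).trans (coe_toFinset M.edgeSet).subset
  have hS_card : Finset.card {e ∈ E | ∃ v ∈ S, v ∈ e} ≤ S.card :=
    card_le_of_isMatching_of_meets hM (h_sub (Finset.filter_subset _ _))
      fun e he => (Finset.mem_filter.1 he).2
  have hW_card i : Finset.card {e ∈ E | ∀ v ∈ e, v ∈ W i} ≤ (W i).card / 2 :=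
    (Nat.le_div_iff_mul_le two_pos).2 (card_mul_two_le_of_isMatching hM
      (h_sub (Finset.filter_subset _ _)) fun e he => (Finset.mem_filter.1 he).2)
  have h_cover : E ⊆ {e ∈ E | ∃ v ∈ S, v ∈ e} ∪
      Finset.univ.biUnion fun i => {e ∈ E | ∀ v ∈ e, v ∈ W i} := fun e he => by
    obtain hS | ⟨i, hi⟩ := hSW e (M.edgeSet_subset (mem_toFinset.1 he))
    · exact Finset.mem_union_left _ (Finset.mem_filter.2 ⟨he, hS⟩)
    · exact Finset.mem_union_right _
        (Finset.mem_biUnion.2 ⟨i, Finset.mem_univ i, Finset.mem_filter.2 ⟨he, hi⟩⟩)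
  calc M.edgeSet.ncard = E.card := ncard_eq_toFinset_card' _
    _ ≤ _ := (Finset.card_le_card h_cover).trans (Finset.card_union_le _ _)
    _ ≤ S.card + ∑ i, (W i).card / 2 := add_le_add hS_card
      (Finset.card_biUnion_le.trans (Finset.sum_le_sum fun i _ => hW_card i))

lemma ncard_edgeSet_le_of_isMatching_bouquet [Fintype V] [DecidableEq V] {r : V} {ι : Type*}
    [Fintype ι] {M : (bouquet G r ι).Subgraph} (hM : M.IsMatching) :
    M.edgeSet.ncard ≤ 1 + Fintype.card ι * ((Fintype.card V - 1) / 2) := by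
  let W (i : ι) : Finset (BouquetVertex r ι) :=
    Finset.univ.map ⟨fun v => some (i, v), fun u v huv => by simpa using huv⟩
  have hW i : (W i).card = Fintype.card V - 1 := by
    rw [Finset.card_map, Finset.card_univ, Fintype.card_subtype_compl, Fintype.card_subtype_eq]
  refine (ncard_edgeSet_le_of_isMatching hM {none} W fun e he => ?_).trans_eq ?_
  · obtain ⟨i, f, -, rfl⟩ := mem_edgeSet_bouquet.1 he
    rw [or_iff_not_imp_left]
    intro h_root
    refine ⟨i, fun x hx => ?_⟩
    obtain ⟨v, -, rfl⟩ := Sym2.mem_map.1 hx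
    have hvr : v ≠ r := by
      rintro rfl
      exact h_root ⟨none, Finset.mem_singleton_self _, bouquetIncl_root (r := v) i ▸ hx⟩
    exact Finset.mem_map.2 ⟨⟨v, hvr⟩, Finset.mem_univ _, (bouquetIncl_coe i ⟨v, hvr⟩).symm⟩
  · simp only [hW, Finset.card_singleton, Finset.sum_const, Finset.card_univ, smul_eq_mul]

end Matching

section Gadget

/-- The vertices of the rhombicuboctahedron: `(k, s)` is the vertex whose coordinates have the
signs `s` and whose `k`-th coordinate is the largest in absolute value. -/
abbrev RhombicuboctahedronVertex : Type := Fin 3 × (Fin 3 → ℤˣ)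

/-- The graph formed by the edges of the rhombicuboctahedron and the diagonals of its squares: two
vertices are adjacent if they lie on a common square. The squares are given by the sign of one
coordinate, which is the largest one, or by the signs of two, one of which is the largest one. -/
def crossedRhombicuboctahedron : SimpleGraph RhombicuboctahedronVertex where
  Adj u v := u.2 u.1 = v.2 u.1 ∧ u.2 v.1 = v.2 v.1 ∧ u ≠ v
  symm := ⟨by tauto⟩
  loopless := ⟨by tauto⟩

instance : DecidableRel crossedRhombicuboctahedron.Adj := fun u v =>
  inferInstanceAs (Decidable (u.2 u.1 = v.2 u.1 ∧ u.2 v.1 = v.2 v.1 ∧ u ≠ v))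

lemma card_rhombicuboctahedronVertex : Fintype.card RhombicuboctahedronVertex = 24 := rfl

lemma isRegularOfDegree_crossedRhombicuboctahedron :
    crossedRhombicuboctahedron.IsRegularOfDegree 7 := by
  intro v
  revert v
  decide +kernel

/-- The coordinates of a vertex of a polyhedron that is combinatorially a rhombicuboctahedron. In
the Archimedean solid the number `12` is replaced by `1 + √2`. -/
def vertexCoord (v : RhombicuboctahedronVertex) (j : Fin 3) : ℤ :=
  v.2 j * if j = v.1 then 12 else 1

/-- The Schlegel diagram of the polyhedron with the coordinates `vertexCoord`: the central
projection from the point `(7, 5, 3)`, which sees only the triangle that contains the root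
`(0, 1)`, onto a plane `x + y + z = const`. The common denominator `19575` of all points is cleared,
which makes the division exact, and the root is moved to the origin. -/
def schlegel (v : RhombicuboctahedronVertex) : ℤ × ℤ :=
  let t := 19575 / (15 - (vertexCoord v 0 + vertexCoord v 1 + vertexCoord v 2))
  (t * (vertexCoord v 1 - 5) + 19575 * 4, t * (vertexCoord v 2 - 3) + 19575 * 2)

lemma schlegel_root : schlegel (0, 1) = 0 := by
  decide +kernel

lemma zero_le_schlegel : ∀ v, 0 ≤ schlegel v := by
  decide +kernel

set_option synthInstance.maxSize 1000 in
lemma inEdgeGeneralPosition_schlegel :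
    InEdgeGeneralPosition crossedRhombicuboctahedron schlegel where
  injective := by unfold Function.Injective; decide +kernel
  orientation_ne_zero := by decide +kernel

set_option synthInstance.maxSize 1000 in
lemma mem_commonNeighbors_iff_of_segmentsCross_schlegel :
    ∀ a b, crossedRhombicuboctahedron.Adj a b → ∀ c d, crossedRhombicuboctahedron.Adj c d →
      SegmentsCross (schlegel a) (schlegel b) (schlegel c) (schlegel d) →
      ∀ w, w ∈ crossedRhombicuboctahedron.commonNeighbors a b ↔ w = c ∨ w = d := by
  simp only [mem_commonNeighbors]
  decide +kernel

lemma crossing_unique_schlegel {a b c d c' d' : RhombicuboctahedronVertex}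
    (hab : crossedRhombicuboctahedron.Adj a b) (hcd : crossedRhombicuboctahedron.Adj c d)
    (hcd' : crossedRhombicuboctahedron.Adj c' d')
    (h : SegmentsCross (schlegel a) (schlegel b) (schlegel c) (schlegel d))
    (h' : SegmentsCross (schlegel a) (schlegel b) (schlegel c') (schlegel d')) :
    s(c, d) = s(c', d') := by
  ext w
  rw [Sym2.mem_iff, Sym2.mem_iff,
    ← mem_commonNeighbors_iff_of_segmentsCross_schlegel a b hab c d hcd h,
    ← mem_commonNeighbors_iff_of_segmentsCross_schlegel a b hab c' d' hcd' h']

/-- The straight-line drawing given by the Schlegel diagram. -/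
def schlegelDrawing : PlaneDrawing crossedRhombicuboctahedron :=
  straightLineDrawing (inEdgeGeneralPosition_schlegel.intCast (R := ℝ))

lemma pos_root_schlegelDrawing : schlegelDrawing.pos (0, 1) = 0 := by
  change Prod.map _ _ (schlegel (0, 1)) = 0
  rw [schlegel_root]
  exact Prod.ext Int.cast_zero Int.cast_zero

lemma support_schlegelDrawing_subset : schlegelDrawing.support ⊆ Ici 0 :=
  support_straightLineDrawing_subset _ (convex_Ici 0) fun v =>
    ⟨Int.cast_nonneg (zero_le_schlegel v).1, Int.cast_nonneg (zero_le_schlegel v).2⟩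

lemma crossings_schlegelDrawing_subsingleton {e : Sym2 RhombicuboctahedronVertex}
    (he : e ∈ crossedRhombicuboctahedron.edgeSet) :
    (schlegelDrawing.crossings e).Subsingleton :=
  crossings_straightLineDrawing_subsingleton _ (fun _ _ _ _ _ _ hab hcd hcd' h h' =>
    crossing_unique_schlegel hab hcd hcd' (segmentsCross_intCast.1 h)
      (segmentsCross_intCast.1 h')) he

end Gadget

theorem mainTheorem2 (N : ℕ) :
    ∃ (V : Type) (_ : Fintype V) (G : SimpleGraph V) (_ : DecidableRel G.Adj),
      N ≤ Fintype.card V ∧ IsOnePlanar G ∧ G.minDegree = 7 ∧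
        ∀ M : G.Subgraph, M.IsMatching →
          (M.edgeSet.ncard : ℚ) ≤ (11 * (Fintype.card V : ℚ) + 12) / 23 := by
  classical
  let G := bouquet crossedRhombicuboctahedron (0, 1) (Fin (N + 1))
  have h_card : Fintype.card (BouquetVertex ((0, 1) : RhombicuboctahedronVertex) (Fin (N + 1))) =
      23 * (N + 1) + 1 := by
    rw [card_bouquetVertex, Fintype.card_fin, card_rhombicuboctahedronVertex, mul_comm]
  refine ⟨_, inferInstance, G, inferInstance, by lia, ?_,
    minDegree_bouquet isRegularOfDegree_crossedRhombicuboctahedron, fun M hM => ?_⟩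
  · exact isOnePlanar_bouquet schlegelDrawing pos_root_schlegelDrawing
      support_schlegelDrawing_subset fun _ => crossings_schlegelDrawing_subsingleton
  · have h_edges : M.edgeSet.ncard ≤ 1 + (N + 1) * 11 := by
      simpa [card_rhombicuboctahedronVertex] using ncard_edgeSet_le_of_isMatching_bouquet hM
    rw [h_card, le_div_iff₀ (by norm_num)]
    norm_cast
    lia
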